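/- Let $p$ be a prime, let $d \ge 0$, and let $\mathbb{C}_p$ be the completion of an algebraic closure of $\mathbb{Q}_p$, with absolute value $|\cdot|_p$ extending the $p$-adic one. Let $T^d_p = \{ z \in \mathbb{C}_p^d : |z_i|_p = 1 \text{ for } 1 \le i \le d \}$ be the $p$-adic $d$-torus. Let $c_0(\mathbb{Z}^d)$ be the commutative $\mathbb{Q}_p$-algebra of formal series $\sum_{\nu \in \mathbb{Z}^d} x_\nu t^\nu$ with $x_\nu \in \mathbb{Q}_p$ such that for every $\varepsilon > 0$ all but finitely many $\nu$ satisfy $|x_\nu|_p < \varepsilon$, with coefficientwise addition and the convolution product $$\Big(\sum_{\nu} x_\nu t^\nu\Big)\Big(\sum_{\nu} y_\nu t^\nu\Big) = \sum_{\nu} \Big(\sum_{\mu \in \mathbb{Z}^d} x_\mu y_{\nu - \mu}\Big) t^\nu .$$ Let $c_0(\mathbb{Z}^d, \mathbb{Z}_p) \subset c_0(\mathbb{Z}^d)$ be the subring of series all of whose coefficients lie in $\mathbb{Z}_p$. The ring of Laurent polynomials $\mathbb{Q}_p[t_1^{\pm 1}, \ldots, t_d^{\pm 1}]$ is contained in $c_0(\mathbb{Z}^d)$.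 For every $f \in \mathbb{Q}_p[t_1^{\pm 1}, \ldots, t_d^{\pm 1}]$ the following conditions are equivalent: a) $f(z) \ne 0$ for every $z \in T^d_p$; b) $f$ is a unit in $c_0(\mathbb{Z}^d)$; c) $f = c\, t^\nu (1 + p g)$ for some $c \in \mathbb{Q}_p^*$, $\nu \in \mathbb{Z}^d$ and $g \in c_0(\mathbb{Z}^d, \mathbb{Z}_p)$. -/

import Mathlib

open Filter Topology

/-- For an additive commutative group `Γ` (such as `ℤ^d`), the space `c₀(Γ)` of formal series
`∑ x_γ γ` with coefficients `x_γ ∈ ℚ_p` such that `|x_γ|_p → 0` as `γ → ∞`: for every `ε > 0`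
all but finitely many `γ` satisfy `|x_γ|_p < ε`. -/
@[ext]
structure PadicC0 (p : ℕ) [Fact p.Prime] (Γ : Type*) where
  /-- The coefficients of the series. -/
  coeff : Γ → ℚ_[p]
  /-- The coefficients tend to zero along the complements of the finite sets. -/
  tendsto_zero : Tendsto coeff cofinite (𝓝 0)

namespace PadicC0

variable {p : ℕ} [Fact p.Prime] {Γ : Type*}

noncomputable instance : Zero (PadicC0 p Γ) := ⟨⟨fun _ => 0, tendsto_const_nhds⟩⟩

noncomputable instance : Add (PadicC0 p Γ) :=
  ⟨fun x y => ⟨fun γ => x.coeff γ + y.coeff γ, by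
    simpa using x.tendsto_zero.add y.tendsto_zero⟩⟩

noncomputable instance : Neg (PadicC0 p Γ) :=
  ⟨fun x => ⟨fun γ => -x.coeff γ, by simpa using x.tendsto_zero.neg⟩⟩

noncomputable instance : SMul ℚ_[p] (PadicC0 p Γ) :=
  ⟨fun c x => ⟨fun γ => c * x.coeff γ, by simpa using x.tendsto_zero.const_mul c⟩⟩

theorem coeff_zero (γ : Γ) : (0 : PadicC0 p Γ).coeff γ = 0 := rfl

theorem coeff_add (x y : PadicC0 p Γ) (γ : Γ) : (x + y).coeff γ = x.coeff γ + y.coeff γ := rfl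

theorem coeff_neg (x : PadicC0 p Γ) (γ : Γ) : (-x).coeff γ = -x.coeff γ := rfl

theorem coeff_smul (c : ℚ_[p]) (x : PadicC0 p Γ) (γ : Γ) :
    (c • x).coeff γ = c * x.coeff γ := rfl

/-- The inclusion of the group ring `ℚ_p[Γ]` in `c₀(Γ)`: a finite sum is a series with the same
coefficients. -/
noncomputable def ofGroupRing (f : AddMonoidAlgebra ℚ_[p] Γ) : PadicC0 p Γ :=
  ⟨fun γ => f.coeff γ, by
    rw [NormedAddGroup.tendsto_nhds_zero]
    intro ε hε
    rw [eventually_cofinite]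
    refine f.coeff.support.finite_toSet.subset fun γ hγ => ?_
    rw [Finset.mem_coe, Finsupp.mem_support_iff]
    intro h0
    exact hγ (by simpa [h0] using hε)⟩

/-- The monomial `t^ν`, that is the group element `ν` seen in `c₀(Γ)`. -/
noncomputable def monomial (ν : Γ) : PadicC0 p Γ := ofGroupRing (AddMonoidAlgebra.single ν 1)

theorem coeff_ofGroupRing (f : AddMonoidAlgebra ℚ_[p] Γ) (γ : Γ) :
    (ofGroupRing f).coeff γ = f.coeff γ := rfl

open Classical in
theorem coeff_monomial (ν γ : Γ) :
    (monomial ν : PadicC0 p Γ).coeff γ = if ν = γ then 1 else 0 := by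
  simp [monomial, coeff_ofGroupRing, Finsupp.single_apply]

variable [AddCommGroup Γ]

theorem summable_conv (x y : PadicC0 p Γ) (γ : Γ) :
    Summable fun a => x.coeff a * y.coeff (γ - a) := by
  have h := NonarchimedeanAddGroup.summable_of_tendsto_cofinite_zero
    (tendsto_mul_cofinite_nhds_zero x.tendsto_zero y.tendsto_zero)
  exact h.comp_injective (i := fun a : Γ => (a, γ - a)) fun a b hab => congrArg Prod.fst hab

theorem tendsto_conv (x y : PadicC0 p Γ) :
    Tendsto (fun γ => ∑' a, x.coeff a * y.coeff (γ - a)) cofinite (𝓝 0) := by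
  rw [NormedAddGroup.tendsto_nhds_zero]
  intro ε hε
  have h := tendsto_mul_cofinite_nhds_zero x.tendsto_zero y.tendsto_zero
  rw [NormedAddGroup.tendsto_nhds_zero] at h
  have hfin := h (ε / 2) (half_pos hε)
  rw [eventually_cofinite] at hfin ⊢
  refine (hfin.image fun q : Γ × Γ => q.1 + q.2).subset ?_
  intro γ hγ
  by_contra hcon
  refine hγ (lt_of_le_of_lt ?_ (half_lt_self hε))
  refine IsUltrametricDist.norm_tsum_le_of_forall_le_of_nonneg (half_pos hε).le fun a => ?_
  by_contra ha
  exact hcon ⟨(a, γ - a), fun hlt => ha hlt.le, by simp⟩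

/-- The convolution product `(x * y)_γ = ∑_{a + b = γ} x_a y_b = ∑_a x_a y_{γ - a}`. -/
noncomputable instance : Mul (PadicC0 p Γ) :=
  ⟨fun x y => ⟨fun γ => ∑' a, x.coeff a * y.coeff (γ - a), tendsto_conv x y⟩⟩

noncomputable instance : One (PadicC0 p Γ) := ⟨monomial 0⟩

theorem coeff_mul (x y : PadicC0 p Γ) (γ : Γ) :
    (x * y).coeff γ = ∑' a, x.coeff a * y.coeff (γ - a) := rfl

theorem one_def : (1 : PadicC0 p Γ) = monomial 0 := rfl

protected theorem mul_comm (x y : PadicC0 p Γ) : x * y = y * x := by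
  ext γ
  rw [coeff_mul, coeff_mul, ← (Equiv.subLeft γ).tsum_eq]
  simp [mul_comm]

protected theorem one_mul (x : PadicC0 p Γ) : 1 * x = x := by
  ext γ
  rw [coeff_mul, tsum_eq_single (0 : Γ)]
  · simp [one_def, coeff_monomial]
  · intro a ha
    simp [one_def, coeff_monomial, ha.symm]

protected theorem add_mul (x y z : PadicC0 p Γ) : (x + y) * z = x * z + y * z := by
  ext γ
  simp only [coeff_mul, coeff_add, add_mul]
  exact (summable_conv x z γ).tsum_add (summable_conv y z γ)

protected theorem mul_assoc (x y z : PadicC0 p Γ) : x * y * z = x * (y * z) := by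
  ext γ
  simp only [coeff_mul]
  have hxy := tendsto_mul_cofinite_nhds_zero x.tendsto_zero y.tendsto_zero
  have hxyz : Summable fun q : Γ × Γ => x.coeff q.1 * y.coeff q.2 * z.coeff (γ - q.1 - q.2) := by
    have h := NonarchimedeanAddGroup.summable_of_tendsto_cofinite_zero
      (tendsto_mul_cofinite_nhds_zero hxy z.tendsto_zero)
    exact h.comp_injective (i := fun q : Γ × Γ => (q, γ - q.1 - q.2))
      fun a b hab => congrArg Prod.fst hab
  let e : Γ × Γ ≃ Γ × Γ :=
    { toFun := fun q => (q.2, q.1 - q.2)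
      invFun := fun q => (q.1 + q.2, q.1)
      left_inv := fun q => by simp
      right_inv := fun q => by simp }
  have hsum : Summable fun q : Γ × Γ =>
      x.coeff q.2 * y.coeff (q.1 - q.2) * z.coeff (γ - q.1) := by
    have h := e.summable_iff.mpr hxyz
    refine h.congr fun q => ?_
    simp [e]
  calc ∑' a, (∑' b, x.coeff b * y.coeff (a - b)) * z.coeff (γ - a)
      = ∑' a, ∑' b, x.coeff b * y.coeff (a - b) * z.coeff (γ - a) := by
        simp only [tsum_mul_right]
    _ = ∑' q : Γ × Γ, x.coeff q.2 * y.coeff (q.1 - q.2) * z.coeff (γ - q.1) :=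
        hsum.tsum_prod.symm
    _ = ∑' q : Γ × Γ, x.coeff q.1 * y.coeff q.2 * z.coeff (γ - q.1 - q.2) := by
        rw [← e.tsum_eq fun q : Γ × Γ => x.coeff q.1 * y.coeff q.2 * z.coeff (γ - q.1 - q.2)]
        simp [e]
    _ = ∑' b, ∑' c, x.coeff b * y.coeff c * z.coeff (γ - b - c) := hxyz.tsum_prod
    _ = ∑' b, x.coeff b * ∑' c, y.coeff c * z.coeff (γ - b - c) := by
        simp only [mul_assoc, tsum_mul_left]

/-- `c₀(Γ)` is a commutative ring under convolution. -/
noncomputable instance : CommRing (PadicC0 p Γ) where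
  add_assoc x y z := by ext γ; exact add_assoc _ _ _
  zero_add x := by ext γ; exact zero_add _
  add_zero x := by ext γ; exact add_zero _
  add_comm x y := by ext γ; exact add_comm _ _
  neg_add_cancel x := by ext γ; exact neg_add_cancel _
  nsmul := nsmulRec
  zsmul := zsmulRec
  mul_assoc := PadicC0.mul_assoc
  mul_comm := PadicC0.mul_comm
  one_mul := PadicC0.one_mul
  mul_one x := by rw [PadicC0.mul_comm, PadicC0.one_mul]
  left_distrib x y z := by
    rw [PadicC0.mul_comm x, PadicC0.add_mul, PadicC0.mul_comm y, PadicC0.mul_comm z]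
  right_distrib := PadicC0.add_mul
  zero_mul x := by ext γ; simp [coeff_mul, coeff_zero]
  mul_zero x := by ext γ; simp [coeff_mul, coeff_zero]

/-- `c₀(Γ)` is a `ℚ_p`-vector space with coefficientwise operations. -/
noncomputable instance : Module ℚ_[p] (PadicC0 p Γ) where
  one_smul x := by ext γ; exact one_mul _
  mul_smul a b x := by ext γ; exact mul_assoc _ _ _
  smul_zero a := by ext γ; exact mul_zero _
  smul_add a x y := by ext γ; exact mul_add _ _ _
  add_smul a b x := by ext γ; exact add_mul _ _ _
  zero_smul x := by ext γ; exact zero_mul _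

/-- `c₀(Γ)` is a `ℚ_p`-algebra. -/
noncomputable instance : Algebra ℚ_[p] (PadicC0 p Γ) :=
  Algebra.ofModule
    (fun c x y => by
      ext γ
      simp only [coeff_mul, coeff_smul, mul_assoc, tsum_mul_left])
    (fun c x y => by
      ext γ
      simp only [coeff_mul, coeff_smul, mul_left_comm _ c, tsum_mul_left])

/-- The subring `c₀(Γ, ℤ_p)` of the series in `c₀(Γ)` all of whose coefficients lie in `ℤ_p`. -/
noncomputable def integral (p : ℕ) [Fact p.Prime] (Γ : Type*) [AddCommGroup Γ] :
    Subring (PadicC0 p Γ) where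
  carrier := {x | ∀ γ, x.coeff γ ∈ PadicInt.subring p}
  zero_mem' _ := zero_mem _
  add_mem' hx hy γ := add_mem (hx γ) (hy γ)
  neg_mem' hx γ := neg_mem (hx γ)
  one_mem' γ := by
    rw [one_def, coeff_monomial]
    split_ifs
    exacts [one_mem _, zero_mem _]
  mul_mem' {x y} hx hy γ := by
    rw [coeff_mul, PadicInt.mem_subring_iff]
    exact IsUltrametricDist.norm_tsum_le_of_forall_le_of_nonneg zero_le_one fun a =>
      (PadicInt.mem_subring_iff p).mp (mul_mem (hx a) (hy (γ - a)))

end PadicC0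

/-- The `p`-adic `d`-torus `{z ∈ ℂ_p^d : |z_i|_p = 1 for all i}`. -/
def padicTorus (p : ℕ) [Fact p.Prime] (d : ℕ) : Set (Fin d → ℂ_[p]) :=
  {z | ∀ i, ‖z i‖ = 1}

/-- The value `f(z) = ∑_ν a_ν z_1^{ν_1} ⋯ z_d^{ν_d}` of a Laurent polynomial
`f = ∑_ν a_ν t^ν` over `ℚ_p` at a point `z` of `ℂ_p^d` with nonzero coordinates. -/
noncomputable def laurentEval {p : ℕ} [Fact p.Prime] {d : ℕ}
    (f : AddMonoidAlgebra ℚ_[p] (Fin d → ℤ)) (z : Fin d → ℂ_[p]) : ℂ_[p] :=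
  f.coeff.sum fun ν a => algebraMap ℚ_[p] ℂ_[p] a * ∏ i, z i ^ ν i

/-! The link between the three conditions is that `f` has one coefficient strictly larger in norm
than all others. No zeros on the torus gives such a coefficient. In one variable, factor into linear
terms: a factor `X - r` with `‖r‖ ≠ 1` preserves dominance (`HasDominantCoeff.X_sub_C_mul`). In
general, restrict `f` to a curve `s ↦ (s ^ k i)` whose exponents separate the monomials of `f`, so
no coefficients merge. Since the value group of `ℚ_p` is discrete, dividing by the dominant term
leaves `1 + p g` with `g` integral (`exists_eq_smul_monomial_mul`). This is a unit by the geometric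
series (`isUnit_one_sub`). Finally, evaluation at a torus point is multiplicative on `c₀`
(`eval_mul`), so a unit vanishes nowhere on the torus. -/

/-! ### Dominant coefficients in one variable -/

/-- A polynomial has a dominant coefficient if one of its coefficients is strictly larger in norm
than all the others. -/
def Polynomial.HasDominantCoeff {K : Type*} [NormedField K] (P : Polynomial K) : Prop :=
  ∃ n, ∀ m, m ≠ n → ‖P.coeff m‖ < ‖P.coeff n‖

namespace Polynomial

variable {K : Type*} [NormedField K]

theorem hasDominantCoeff_C {a : K} (ha : a ≠ 0) : (C a).HasDominantCoeff :=
  ⟨0, fun m hm => by simpa [coeff_C, hm] using ha⟩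

/-- In norm, `X - r` acts on the dominant term like `X` when `‖r‖ < 1`, moving its index from `n` to
`n + 1`, and like `-r` when `‖r‖ > 1`, keeping the index `n`. -/
theorem HasDominantCoeff.X_sub_C_mul [IsUltrametricDist K] {P : Polynomial K}
    (hP : P.HasDominantCoeff) {r : K} (hr : ‖r‖ ≠ 1) : ((X - C r) * P).HasDominantCoeff := by
  obtain ⟨n, hn⟩ := hP
  have hpos : 0 < ‖P.coeff n‖ := (norm_nonneg _).trans_lt (hn (n + 1) (by simp))
  have hle : ∀ m, ‖P.coeff m‖ ≤ ‖P.coeff n‖ := fun m => by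
    by_cases h : m = n
    · rw [h]
    · exact (hn m h).le
  have hsucc : ∀ m, ((X - C r) * P).coeff (m + 1) = P.coeff m - r * P.coeff (m + 1) := fun m => by
    simp [sub_mul]
  have hzero : ((X - C r) * P).coeff 0 = - (r * P.coeff 0) := by simp [sub_mul]
  have hsub : ∀ x y : K, ‖x - y‖ ≤ max ‖x‖ ‖y‖ := fun x y => by
    simpa [sub_eq_add_neg] using IsUltrametricDist.norm_add_le_max x (-y)
  have hsubeq : ∀ x y : K, ‖x‖ ≠ ‖y‖ → ‖x - y‖ = max ‖x‖ ‖y‖ := fun x y h => by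
    simpa [sub_eq_add_neg] using
      IsUltrametricDist.norm_add_eq_max_of_norm_ne_norm (x := x) (y := -y) (by simpa using h)
  rcases hr.lt_or_gt with h1 | h1
  · have hsmall : ∀ m, ‖r * P.coeff m‖ < ‖P.coeff n‖ := fun m => by
      rw [norm_mul]
      nlinarith [hle m, norm_nonneg (P.coeff m), norm_nonneg r]
    refine ⟨n + 1, fun m hm => ?_⟩
    have htop : ‖((X - C r) * P).coeff (n + 1)‖ = ‖P.coeff n‖ := by
      rw [hsucc, hsubeq _ _ (hsmall _).ne',
        max_eq_left (hsmall _).le]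
    rw [htop]
    cases m with
    | zero => rw [hzero, norm_neg]; exact hsmall 0
    | succ m =>
      rw [hsucc]
      exact (hsub _ _).trans_lt (max_lt (hn m (by simpa using hm)) (hsmall _))
  · have hbig : ‖P.coeff n‖ < ‖r‖ * ‖P.coeff n‖ := by nlinarith
    refine ⟨n, fun m hm => ?_⟩
    have htop : ‖((X - C r) * P).coeff n‖ = ‖r‖ * ‖P.coeff n‖ := by
      cases n with
      | zero => rw [hzero, norm_neg, norm_mul]
      | succ n =>
        have hlt : ‖P.coeff n‖ < ‖r * P.coeff (n + 1)‖ := by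
          rw [norm_mul]; exact (hle n).trans_lt hbig
        rw [hsucc, hsubeq _ _ hlt.ne,
          max_eq_right hlt.le, norm_mul]
    have hother : ‖r * P.coeff m‖ < ‖r‖ * ‖P.coeff n‖ := by
      rw [norm_mul]
      exact mul_lt_mul_of_pos_left (hn m hm) (zero_lt_one.trans h1)
    rw [htop]
    cases m with
    | zero => rwa [hzero, norm_neg]
    | succ m =>
      rw [hsucc]
      exact (hsub _ _).trans_lt (max_lt ((hle m).trans_lt hbig) hother)

/-- A polynomial over an algebraically closed ultrametric field without roots of norm `1` has a
dominant coefficient. -/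
theorem hasDominantCoeff_of_norm_root_ne_one [IsUltrametricDist K] [IsAlgClosed K]
    {P : Polynomial K} (hP : P ≠ 0) (hroot : ∀ r ∈ P.roots, ‖r‖ ≠ 1) : P.HasDominantCoeff := by
  rw [(IsAlgClosed.splits P).eq_prod_roots, mul_comm]
  generalize P.roots = s at hroot
  induction s using Multiset.induction_on with
  | empty => simpa using hasDominantCoeff_C (leadingCoeff_ne_zero.mpr hP)
  | cons r s ih =>
    rw [Multiset.map_cons, Multiset.prod_cons, mul_assoc]
    exact (ih fun x hx => hroot x (Multiset.mem_cons_of_mem hx)).X_sub_C_mul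
      (hroot r (Multiset.mem_cons_self r s))

end Polynomial

/-! ### Reduction of Laurent polynomials to one variable -/

/-- Finitely many points of `ℤ^d` are separated by an integral linear form. -/
theorem Finset.exists_int_linear_injOn {d : ℕ} (S : Finset (Fin d → ℤ)) :
    ∃ k : Fin d → ℤ, Set.InjOn (fun ν : Fin d → ℤ => ∑ i, k i * ν i) S := by
  classical
  -- With `k i = t ^ i`, the form takes the value `(Q δ).eval t` at `δ`; it remains to choose `t`
  -- outside the zeros of finitely many nonzero polynomials.
  let Q : (Fin d → ℤ) → Polynomial ℤ := fun δ =>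
    ∑ i, Polynomial.C (δ i) * Polynomial.X ^ (i : ℕ)
  have hQ : ∀ δ, δ ≠ 0 → Q δ ≠ 0 := fun δ hδ h0 => hδ <| by
    ext i
    have := congrArg (fun P => Polynomial.coeff P (i : ℕ)) h0
    simpa [Q, Polynomial.finsetSum_coeff, Polynomial.coeff_X_pow, Fin.val_inj] using this
  have hprod : ∏ q ∈ S.offDiag, Q (q.1 - q.2) ≠ 0 :=
    Finset.prod_ne_zero_iff.mpr fun q hq => hQ _ (sub_ne_zero.mpr (Finset.mem_offDiag.mp hq).2.2)
  obtain ⟨t, ht⟩ : ∃ t : ℤ, (∏ q ∈ S.offDiag, Q (q.1 - q.2)).eval t ≠ 0 := by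
    by_contra! h
    exact hprod (Polynomial.funext fun t => by simpa using h t)
  refine ⟨fun i => t ^ (i : ℕ), fun a ha b hb hab => ?_⟩
  by_contra hne
  rw [Polynomial.eval_prod, Finset.prod_ne_zero_iff] at ht
  refine ht (a, b) (Finset.mem_offDiag.mpr ⟨ha, hb, hne⟩) ?_
  simp only [Q, Polynomial.eval_finsetSum, Polynomial.eval_mul, Polynomial.eval_C,
    Polynomial.eval_pow, Polynomial.eval_X, Pi.sub_apply, sub_mul, Finset.sum_sub_distrib]
  rw [sub_eq_zero]
  simpa only [mul_comm] using hab

/-- A Laurent polynomial without zeros on the `p`-adic torus has a coefficient that is strictly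
larger in norm than all the others. -/
theorem exists_dominant_coeff_of_laurentEval_ne_zero {p : ℕ} [Fact p.Prime] {d : ℕ}
    {f : AddMonoidAlgebra ℚ_[p] (Fin d → ℤ)} (hf : ∀ z ∈ padicTorus p d, laurentEval f z ≠ 0) :
    ∃ ν, f.coeff ν ≠ 0 ∧ ∀ μ, μ ≠ ν → ‖f.coeff μ‖ < ‖f.coeff ν‖ := by
  classical
  obtain ⟨k, hk⟩ := Finset.exists_int_linear_injOn f.coeff.support
  let l : (Fin d → ℤ) → ℤ := fun ν => ∑ i, k i * ν i
  -- A shift making every exponent `l ν + N` nonnegative on the support, where `toNat` then loses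
  -- nothing.
  let N : ℤ := ∑ ν ∈ f.coeff.support, |l ν|
  have hN : ∀ ν ∈ f.coeff.support, 0 ≤ l ν + N := fun ν hν => by
    have h1 : |l ν| ≤ N := Finset.single_le_sum (f := fun ν => |l ν|) (fun _ _ => abs_nonneg _) hν
    linarith [neg_abs_le (l ν)]
  let e : (Fin d → ℤ) → ℕ := fun ν => (l ν + N).toNat
  have he : ∀ ν ∈ f.coeff.support, (e ν : ℤ) = l ν + N := fun ν hν => Int.toNat_of_nonneg (hN ν hν)
  have heinj : Set.InjOn e f.coeff.support := fun a ha b hb hab => hk ha hb <| by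
    have h1 := he a ha
    rw [hab, he b hb] at h1
    exact (add_right_cancel h1).symm
  let P : Polynomial ℂ_[p] := ∑ ν ∈ f.coeff.support,
    Polynomial.C (algebraMap ℚ_[p] ℂ_[p] (f.coeff ν)) * Polynomial.X ^ e ν
  have hcoeff : ∀ ν ∈ f.coeff.support, ‖P.coeff (e ν)‖ = ‖f.coeff ν‖ := fun ν hν => by
    have : P.coeff (e ν) = algebraMap ℚ_[p] ℂ_[p] (f.coeff ν) := by
      simp only [P, Polynomial.finsetSum_coeff, Polynomial.coeff_C_mul, Polynomial.coeff_X_pow]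
      rw [Finset.sum_eq_single_of_mem ν hν]
      · simp
      · intro μ hμ hne
        rw [if_neg fun h => hne (heinj hμ hν h.symm), mul_zero]
    rw [this, norm_algebraMap']
  have hzero : ∀ m, P.coeff m ≠ 0 → ∃ ν ∈ f.coeff.support, e ν = m := fun m hm => by
    by_contra! h
    refine hm ?_
    simp only [P, Polynomial.finsetSum_coeff, Polynomial.coeff_C_mul, Polynomial.coeff_X_pow]
    exact Finset.sum_eq_zero fun ν hν => by rw [if_neg (h ν hν).symm, mul_zero]
  have heval : ∀ s : ℂ_[p], s ≠ 0 →
      P.eval s = s ^ N * laurentEval f fun i => s ^ k i := fun s hs => by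
    simp only [P, Polynomial.eval_finsetSum, Polynomial.eval_mul, Polynomial.eval_C,
      Polynomial.eval_pow, Polynomial.eval_X, laurentEval, Finsupp.sum, Finset.mul_sum]
    refine Finset.sum_congr rfl fun ν hν => ?_
    have hprod : ∏ i, (s ^ k i) ^ ν i = s ^ l ν := by
      simp only [← zpow_mul, l]
      induction (Finset.univ : Finset (Fin d)) using Finset.induction_on with
      | empty => simp
      | insert i t hi ih => rw [Finset.prod_insert hi, Finset.sum_insert hi, zpow_add₀ hs, ih]
    rw [hprod, ← zpow_natCast, he ν hν, zpow_add₀ hs]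
    ring
  have hP : P ≠ 0 := by
    intro hP
    refine hf (fun _ => 1) (fun i => norm_one) ?_
    have := heval 1 one_ne_zero
    simpa [hP] using this.symm
  -- A root `s` of norm `1` would give the zero `(s ^ k i)` of `f` on the torus.
  obtain ⟨n, hn⟩ := Polynomial.hasDominantCoeff_of_norm_root_ne_one hP fun s hs h1 => by
    have hs0 : s ≠ 0 := fun h => by simp [h] at h1
    have h := heval s hs0
    rw [(Polynomial.mem_roots hP).mp hs] at h
    refine hf (fun i => s ^ k i) (fun i => by rw [norm_zpow, h1, one_zpow]) ?_
    exact (mul_eq_zero.mp h.symm).resolve_left (zpow_ne_zero _ hs0)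
  have hpos : 0 < ‖P.coeff n‖ := (norm_nonneg _).trans_lt (hn (n + 1) (by simp))
  obtain ⟨ν, hν, rfl⟩ := hzero n (norm_pos_iff.mp hpos)
  refine ⟨ν, Finsupp.mem_support_iff.mp hν, fun μ hμ => ?_⟩
  by_cases hμs : μ ∈ f.coeff.support
  · rw [← hcoeff μ hμs, ← hcoeff ν hν]
    exact hn _ fun h => hμ (heinj hμs hν h)
  · rw [Finsupp.notMem_support_iff.mp hμs, norm_zero]
    exact norm_pos_iff.mpr (Finsupp.mem_support_iff.mp hν)

/-! ### Evaluation of series at characters -/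

/-- The sum of a convolution of null families in a complete ultrametric field is the product of
their sums. -/
theorem tsum_tsum_mul_sub_of_tendsto {Γ K : Type*} [AddCommGroup Γ] [NormedField K]
    [CompleteSpace K] [IsUltrametricDist K] {X Y : Γ → K} (hX : Tendsto X cofinite (𝓝 0))
    (hY : Tendsto Y cofinite (𝓝 0)) :
    ∑' γ, ∑' a, X a * Y (γ - a) = (∑' a, X a) * ∑' b, Y b := by
  have hF : Summable fun q : Γ × Γ => X q.1 * Y q.2 :=
    NonarchimedeanAddGroup.summable_of_tendsto_cofinite_zero (tendsto_mul_cofinite_nhds_zero hX hY)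
  let e : Γ × Γ ≃ Γ × Γ :=
    { toFun := fun q => (q.2, q.1 - q.2)
      invFun := fun q => (q.1 + q.2, q.1)
      left_inv := fun q => by simp
      right_inv := fun q => by simp }
  have hFe : Summable fun q : Γ × Γ => X q.2 * Y (q.1 - q.2) := e.summable_iff.mpr hF
  calc ∑' γ, ∑' a, X a * Y (γ - a)
      = ∑' q : Γ × Γ, X q.2 * Y (q.1 - q.2) := hFe.tsum_prod.symm
    _ = ∑' q : Γ × Γ, X q.1 * Y q.2 := e.tsum_eq fun q : Γ × Γ => X q.1 * Y q.2
    _ = ∑' a, ∑' b, X a * Y b := hF.tsum_prod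
    _ = (∑' a, X a) * ∑' b, Y b := by simp only [tsum_mul_left, tsum_mul_right]

namespace PadicC0

variable {p : ℕ} [Fact p.Prime] {Γ : Type*}

section Eval

variable {K : Type*} [NormedField K] [NormedAlgebra ℚ_[p] K]

/-- The value `∑ x_γ χ(γ)` of a series at a function `χ` of norm at most `1`. -/
noncomputable def eval (χ : Γ → K) (x : PadicC0 p Γ) : K :=
  ∑' γ, algebraMap ℚ_[p] K (x.coeff γ) * χ γ

theorem tendsto_eval {χ : Γ → K} (hχ : ∀ γ, ‖χ γ‖ ≤ 1) (x : PadicC0 p Γ) :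
    Tendsto (fun γ => algebraMap ℚ_[p] K (x.coeff γ) * χ γ) cofinite (𝓝 0) := by
  refine squeeze_zero_norm (fun γ => ?_) (tendsto_zero_iff_norm_tendsto_zero.mp x.tendsto_zero)
  rw [norm_mul, norm_algebraMap']
  exact mul_le_of_le_one_right (norm_nonneg _) (hχ γ)

theorem eval_ofGroupRing (χ : Γ → K) (f : AddMonoidAlgebra ℚ_[p] Γ) :
    eval χ (ofGroupRing f) = f.coeff.sum fun γ a => algebraMap ℚ_[p] K a * χ γ := by
  rw [eval, tsum_eq_sum (s := f.coeff.support)]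
  · rfl
  · intro γ hγ
    rw [coeff_ofGroupRing, Finsupp.notMem_support_iff.mp hγ, map_zero, zero_mul]

theorem eval_one [AddCommGroup Γ] {χ : Γ → K} (hχ0 : χ 0 = 1) :
    eval χ (1 : PadicC0 p Γ) = 1 := by
  rw [one_def, monomial, eval_ofGroupRing, AddMonoidAlgebra.coeff_single,
    Finsupp.sum_single_index (by simp), map_one, one_mul, hχ0]

/-- Since `χ γ = χ a * χ (γ - a)`, twisting coefficients by `χ` respects convolution, and summation
turns convolution into a product. -/
theorem eval_mul [CompleteSpace K] [IsUltrametricDist K] [AddCommGroup Γ] {χ : Γ → K}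
    (hχ : ∀ γ, ‖χ γ‖ ≤ 1) (hadd : ∀ a b, χ (a + b) = χ a * χ b) (x y : PadicC0 p Γ) :
    eval χ (x * y) = eval χ x * eval χ y := by
  have hterm : ∀ γ, algebraMap ℚ_[p] K ((x * y).coeff γ) * χ γ =
      ∑' a, (algebraMap ℚ_[p] K (x.coeff a) * χ a) *
        (algebraMap ℚ_[p] K (y.coeff (γ - a)) * χ (γ - a)) := fun γ => by
    rw [coeff_mul, (summable_conv x y γ).map_tsum (algebraMap ℚ_[p] K)
      (continuous_algebraMap ℚ_[p] K), ← tsum_mul_right]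
    refine tsum_congr fun a => ?_
    have : χ γ = χ a * χ (γ - a) := by rw [← hadd, add_sub_cancel]
    rw [map_mul, this]
    ring
  rw [eval, tsum_congr hterm]
  exact tsum_tsum_mul_sub_of_tendsto (tendsto_eval hχ x) (tendsto_eval hχ y)

end Eval

/-! ### Units of `c₀(Γ)` -/

variable [AddCommGroup Γ]

theorem coeff_sub (x y : PadicC0 p Γ) (γ : Γ) : (x - y).coeff γ = x.coeff γ - y.coeff γ := by
  rw [sub_eq_add_neg, sub_eq_add_neg]
  rfl

theorem mem_integral_iff {x : PadicC0 p Γ} : x ∈ integral p Γ ↔ ∀ γ, ‖x.coeff γ‖ ≤ 1 :=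
  forall_congr' fun _ => PadicInt.mem_subring_iff p

theorem norm_coeff_mul_le {x y : PadicC0 p Γ} {ε : ℝ} (hx : x ∈ integral p Γ) (hε : 0 ≤ ε)
    (hy : ∀ γ, ‖y.coeff γ‖ ≤ ε) (γ : Γ) : ‖(x * y).coeff γ‖ ≤ ε := by
  rw [coeff_mul]
  refine IsUltrametricDist.norm_tsum_le_of_forall_le_of_nonneg hε fun a => ?_
  rw [norm_mul]
  exact (mul_le_of_le_one_left (norm_nonneg _) (mem_integral_iff.mp hx a)).trans (hy _)

/-- `1 - u` is invertible in `c₀(Γ)` if all the coefficients of `u` have norm at most `r < 1`. -/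
theorem isUnit_one_sub {u : PadicC0 p Γ} {r : ℝ} (hr0 : 0 ≤ r) (hr1 : r < 1)
    (hu : ∀ γ, ‖u.coeff γ‖ ≤ r) : IsUnit (1 - u) := by
  have huint : u ∈ integral p Γ := mem_integral_iff.mpr fun γ => (hu γ).trans hr1.le
  have hpow : ∀ n γ, ‖(u ^ n).coeff γ‖ ≤ r ^ n := by
    intro n
    induction n with
    | zero => simpa using mem_integral_iff.mp (one_mem (integral p Γ))
    | succ n ih =>
      intro γ
      rw [pow_succ', coeff_mul]
      refine IsUltrametricDist.norm_tsum_le_of_forall_le_of_nonneg (by positivity) fun a => ?_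
      rw [norm_mul, pow_succ']
      exact mul_le_mul (hu a) (ih _) (norm_nonneg _) hr0
  have htend : Tendsto (fun n : ℕ => r ^ n) atTop (𝓝 0) :=
    tendsto_pow_atTop_nhds_zero_of_lt_one hr0 hr1
  have hsum : ∀ γ, Summable fun n => (u ^ n).coeff γ := fun γ =>
    NonarchimedeanAddGroup.summable_of_tendsto_cofinite_zero <| by
      rw [Nat.cofinite_eq_atTop]
      exact squeeze_zero_norm (fun n => hpow n γ) htend
  have hcoeff : ∀ N γ, (∑ n ∈ Finset.range N, u ^ n).coeff γ =
      ∑ n ∈ Finset.range N, (u ^ n).coeff γ := fun N γ => by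
    induction N with
    | zero => rfl
    | succ N ih => rw [Finset.sum_range_succ, Finset.sum_range_succ, coeff_add, ih]
  have htail : ∀ N γ, ‖(∑' n, (u ^ n).coeff γ) - (∑ n ∈ Finset.range N, u ^ n).coeff γ‖ ≤ r ^ N :=
    fun N γ => by
      rw [hcoeff, ← (hsum γ).sum_add_tsum_nat_add N, add_sub_cancel_left]
      refine IsUltrametricDist.norm_tsum_le_of_forall_le_of_nonneg (by positivity) fun n => ?_
      exact (hpow _ γ).trans (pow_le_pow_of_le_one hr0 hr1.le (Nat.le_add_left N n))
  -- The geometric series, summed coefficientwise. Its tails are bounded by `r ^ N` uniformly in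
  -- `γ`, so its coefficients inherit decay from the partial sums.
  let v : PadicC0 p Γ := ⟨fun γ => ∑' n, (u ^ n).coeff γ, by
    rw [NormedAddGroup.tendsto_nhds_zero]
    intro ε hε
    obtain ⟨N, hN⟩ := (htend.eventually (gt_mem_nhds hε)).exists
    filter_upwards [(NormedAddGroup.tendsto_nhds_zero.mp
      (∑ n ∈ Finset.range N, u ^ n).tendsto_zero) ε hε] with γ hγ
    rw [← sub_add_cancel (∑' n, (u ^ n).coeff γ) ((∑ n ∈ Finset.range N, u ^ n).coeff γ)]
    exact (IsUltrametricDist.norm_add_le_max _ _).trans_lt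
      (max_lt ((htail N γ).trans_lt hN) hγ)⟩
  have h1u : 1 - u ∈ integral p Γ := sub_mem (one_mem _) huint
  refine IsUnit.of_mul_eq_one v (sub_eq_zero.mp ?_)
  ext γ
  rw [coeff_zero, ← norm_le_zero_iff]
  refine ge_of_tendsto' htend fun N => ?_
  have hdecomp : (1 - u) * v - 1 = (1 - u) * (v - ∑ n ∈ Finset.range N, u ^ n) - u ^ N := by
    rw [mul_sub, mul_neg_geom_sum]
    ring
  rw [hdecomp, coeff_sub, sub_eq_add_neg]
  refine (IsUltrametricDist.norm_add_le_max _ _).trans (max_le ?_ ?_)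
  · exact norm_coeff_mul_le h1u (by positivity) (fun γ => by rw [coeff_sub]; exact htail N γ) γ
  · rw [norm_neg]
    exact hpow N γ

theorem isUnit_one_add_p_smul {g : PadicC0 p Γ} (hg : g ∈ integral p Γ) :
    IsUnit (1 + (p : ℚ_[p]) • g) := by
  rw [← sub_neg_eq_add]
  refine isUnit_one_sub (norm_nonneg (p : ℚ_[p])) Padic.norm_p_lt_one fun γ => ?_
  rw [coeff_neg, norm_neg, coeff_smul, norm_mul]
  exact mul_le_of_le_one_right (norm_nonneg _) (mem_integral_iff.mp hg γ)

theorem coeff_monomial_mul (ν : Γ) (x : PadicC0 p Γ) (γ : Γ) :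
    (monomial ν * x).coeff γ = x.coeff (γ - ν) := by
  rw [coeff_mul, tsum_eq_single ν]
  · simp [coeff_monomial]
  · intro a ha
    simp [coeff_monomial, ha.symm]

theorem isUnit_monomial (ν : Γ) : IsUnit (monomial ν : PadicC0 p Γ) := by
  classical
  refine IsUnit.of_mul_eq_one (monomial (-ν)) ?_
  ext γ
  rw [coeff_monomial_mul, one_def, coeff_monomial, coeff_monomial]
  simp [eq_comm]

theorem isUnit_smul {c : ℚ_[p]} (hc : c ≠ 0) {x : PadicC0 p Γ} (hx : IsUnit x) :
    IsUnit (c • x) := by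
  rw [Algebra.smul_def]
  exact ((IsUnit.mk0 c hc).map _).mul hx

/-- A series with a dominant coefficient is, up to a scalar and a monomial, congruent to `1`
modulo `p`. -/
theorem exists_eq_smul_monomial_mul {x : PadicC0 p Γ} {ν : Γ} (hν : x.coeff ν ≠ 0)
    (h : ∀ μ, μ ≠ ν → ‖x.coeff μ‖ < ‖x.coeff ν‖) :
    ∃ g ∈ integral p Γ, x = x.coeff ν • (monomial ν * (1 + (p : ℚ_[p]) • g)) := by
  have hp : (p : ℚ_[p]) ≠ 0 := Nat.cast_ne_zero.mpr (Fact.out : p.Prime).ne_zero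
  let g : PadicC0 p Γ :=
    (p : ℚ_[p])⁻¹ • ((x.coeff ν)⁻¹ • (monomial (-ν) * x) - 1)
  have hg : ∀ γ, (p : ℚ_[p]) * g.coeff γ =
      (x.coeff ν)⁻¹ * x.coeff (γ + ν) - (1 : PadicC0 p Γ).coeff γ := fun γ => by
    simp only [g, coeff_smul, coeff_sub, coeff_monomial_mul, sub_neg_eq_add]
    rw [mul_inv_cancel_left₀ hp]
  refine ⟨g, mem_integral_iff.mpr fun γ => ?_, ?_⟩
  · by_cases hγ : γ = 0
    · have h0 : (p : ℚ_[p]) * g.coeff γ = 0 := by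
        rw [hg, hγ, zero_add, inv_mul_cancel₀ hν, one_def, coeff_monomial, if_pos rfl, sub_self]
      rw [(mul_eq_zero.mp h0).resolve_left hp, norm_zero]
      exact zero_le_one
    · have hlt : ‖(p : ℚ_[p]) * g.coeff γ‖ < (p : ℝ) ^ (0 : ℤ) := by
        rw [hg, one_def, coeff_monomial, if_neg (Ne.symm hγ), sub_zero, norm_mul, norm_inv,
          zpow_zero, inv_mul_lt_one₀ (norm_pos_iff.mpr hν)]
        exact h _ (by simpa using hγ)
      -- Discreteness of the valuation: norm less than `1` means norm at most `p⁻¹`, which absorbs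
      -- the division by `p` in `g`.
      rw [Padic.norm_lt_pow_iff_norm_le_pow_sub_one, norm_mul, Padic.norm_p, zero_sub,
        zpow_neg_one] at hlt
      have hp0 : (0 : ℝ) < (p : ℝ)⁻¹ :=
        inv_pos.mpr (Nat.cast_pos.mpr (Fact.out : p.Prime).pos)
      exact (mul_le_iff_le_one_right hp0).mp hlt
  · ext γ
    rw [coeff_smul, coeff_monomial_mul, coeff_add, coeff_smul, hg, sub_add_cancel,
      add_sub_cancel, mul_inv_cancel_left₀ hν]

end PadicC0

/-! ### The equivalence -/

theorem laurentEval_ne_zero_of_isUnit {p : ℕ} [Fact p.Prime] {d : ℕ}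
    {f : AddMonoidAlgebra ℚ_[p] (Fin d → ℤ)} (hf : IsUnit (PadicC0.ofGroupRing f))
    {z : Fin d → ℂ_[p]} (hz : z ∈ padicTorus p d) : laurentEval f z ≠ 0 := by
  obtain ⟨y, hy⟩ := hf.exists_right_inv
  have hz0 : ∀ i, z i ≠ 0 := fun i h => by simpa [h] using hz i
  let χ : (Fin d → ℤ) → ℂ_[p] := fun ν => ∏ i, z i ^ ν i
  have hχ : ∀ ν, ‖χ ν‖ ≤ 1 := fun ν => by
    simp only [χ, norm_prod, norm_zpow]
    exact (Finset.prod_eq_one fun i _ => by rw [hz i, one_zpow]).le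
  have hadd : ∀ a b, χ (a + b) = χ a * χ b := fun a b => by
    simp only [χ, Pi.add_apply, zpow_add₀ (hz0 _), Finset.prod_mul_distrib]
  have h := congrArg (PadicC0.eval χ) hy
  rw [PadicC0.eval_mul hχ hadd, PadicC0.eval_one (by simp [χ]), PadicC0.eval_ofGroupRing] at h
  exact left_ne_zero_of_mul_eq_one h

theorem proposition2p13 (p : ℕ) [Fact p.Prime] (d : ℕ)
    (f : AddMonoidAlgebra ℚ_[p] (Fin d → ℤ)) :
    List.TFAE [
      ∀ z ∈ padicTorus p d, laurentEval f z ≠ 0,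
      IsUnit (PadicC0.ofGroupRing f),
      ∃ c : ℚ_[p], c ≠ 0 ∧ ∃ ν : Fin d → ℤ, ∃ g ∈ PadicC0.integral p (Fin d → ℤ),
        PadicC0.ofGroupRing f = c • (PadicC0.monomial ν * (1 + (p : ℚ_[p]) • g))] := by
  tfae_have 1 → 3 := fun h => by
    obtain ⟨ν, hν, hdom⟩ := exists_dominant_coeff_of_laurentEval_ne_zero h
    exact ⟨f.coeff ν, hν, ν, PadicC0.exists_eq_smul_monomial_mul
      (x := PadicC0.ofGroupRing f) hν hdom⟩
  tfae_have 3 → 2 := by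
    rintro ⟨c, hc, ν, g, hg, h⟩
    rw [h]
    exact PadicC0.isUnit_smul hc
      ((PadicC0.isUnit_monomial ν).mul (PadicC0.isUnit_one_add_p_smul hg))
  tfae_have 2 → 1 := fun h z hz => laurentEval_ne_zero_of_isUnit h hz
  tfae_finish
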